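/- Let $0\le m\le n$, let $M\subset\mathbb R^m$ be a simply connected open set with a smooth Riemannian metric $g$, and let $\nu:M\to G_{n-m}(\mathbb R^n)$ be a smooth map into the Grassmannian of $(n-m)$-dimensional subspaces of $\mathbb R^n$, with a smooth orthonormal frame $(\nu^\alpha)_{\alpha=1,\dots,n-m}$ of $\nu$ on $M$. Write $(\cdot)^T$ for the orthogonal projection onto $\nu^\perp$, let $A^\alpha=(d\nu^\alpha)^T:TM\to\nu^\perp$ be the Weingarten operators, $(A^\alpha)^*:\nu^\perp\to TM$ their adjoints with respect to $g$ and the Euclidean inner product, and $k^{\alpha\beta}=(A^\alpha)^*A^\beta$. Assume that at least one $A^\alpha$ is invertible at every point of $M$. Call $(g,\nu)$ admissible if there is a solution, that is, a smooth isometric immersion $u:(M,g)\to\mathbb R^n$ whose normal space at every $x\in M$ is $\nu(x)$. Then $(g,\nu)$ is admissible if and only if there exist smooth symmetric bilinear forms $h^\alpha$ on $TM$ (regarded via $g$ also as endomorphisms of $TM$) with $h^\alpha h^\beta=k^{\alpha\beta}$ for all $\alpha,\beta$, and a smooth vector bundle homomorphism $U:TM\to\nu^\perp$ with $h^\alpha=-(A^\alpha)^*U$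 for all $\alpha$, such that $U$ is parallel with respect to the Levi-Civita connection on $TM$ and the projection connection $\nabla_v s=(\partial_v s)^T$ on $\nu^\perp$. Moreover, the corresponding immersion is determined by $du=U$: for every such $(h^\alpha)$ and $U$ there is a solution $u$ with $du=U$, any map $u'$ on $M$ with $du'=U$ differs from $u$ by a constant vector, and conversely every solution $u$ arises in this way, with $U=du$ and suitable $h^\alpha$. -/

import Mathlib

open scoped ContDiff

namespace GaussMetric

/-- Euclidean `k`-space. -/
abbrev Euc (k : ℕ) : Type := EuclideanSpace ℝ (Fin k)

/-- The Grassmannian of `k`-dimensional linear subspaces of `ℝ^n`. -/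
abbrev Gr (k n : ℕ) : Type := {V : Submodule ℝ (Euc n) // Module.finrank ℝ V = k}

/-- Fields of bilinear forms on (subsets of) `ℝ^m`: the tangent space at each point is `ℝ^m`. -/
abbrev FormField (m : ℕ) : Type := Euc m → Euc m →L[ℝ] Euc m →L[ℝ] ℝ

/-- `g` is a smooth Riemannian metric on the open set `M ⊆ ℝ^m`. -/
structure IsRiemannianMetricOn {m : ℕ} (M : Set (Euc m)) (g : FormField m) : Prop where
  smooth : ContDiffOn ℝ ∞ g M
  symm : ∀ x ∈ M, ∀ v w, g x v w = g x w v
  pos : ∀ x ∈ M, ∀ v, v ≠ 0 → 0 < g x v v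

/-- Smoothness of a map into the Grassmannian, the latter being embedded in the space of
endomorphisms of `ℝ^n` by sending a subspace to the orthogonal projection onto it. -/
def IsSmoothGrOn {m k n : ℕ} (M : Set (Euc m)) (ν : Euc m → Gr k n) : Prop :=
  ContDiffOn ℝ ∞ (fun x => (ν x).1.starProjection) M

/-- The fibre over `x` of the bundle `ν^⊥`. -/
noncomputable abbrev perp {m k n : ℕ} (ν : Euc m → Gr k n) (x : Euc m) : Submodule ℝ (Euc n) := (ν x).1ᗮ

/-- `e` is a smooth field of orthonormal bases of `ν` on `M`. -/
structure IsOrthonormalFrameOn {m k n : ℕ} (M : Set (Euc m)) (ν : Euc m → Gr k n)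
    (e : Fin k → Euc m → Euc n) : Prop where
  smooth : ∀ α, ContDiffOn ℝ ∞ (e α) M
  orthonormal : ∀ x ∈ M, Orthonormal ℝ (fun α => e α x)
  span : ∀ x ∈ M, Submodule.span ℝ (Set.range fun α => e α x) = (ν x).1

/-- The Weingarten operator `(dν^α)^T : T_xM → ν(x)^⊥` of the section `s = ν^α` of `ν`. -/
noncomputable def weingarten {m k n : ℕ} (ν : Euc m → Gr k n) (s : Euc m → Euc n) (x : Euc m) :
    Euc m →L[ℝ] perp ν x :=
  (perp ν x).orthogonalProjectionOnto ∘L fderiv ℝ s x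

/-- Raising an index: the vector `♯φ` with `b (♯φ) = φ`, for `b` a (nondegenerate) inner
product. -/
noncomputable def sharp {m : ℕ} (b : Euc m →L[ℝ] Euc m →L[ℝ] ℝ) :
    (Euc m →L[ℝ] ℝ) →L[ℝ] Euc m :=
  ContinuousLinearMap.inverse b

/-- The endomorphism `h` with `b (h v) w = q v w`, for `b` an inner product, `q` bilinear. -/
noncomputable def toEnd {m : ℕ} (b q : Euc m →L[ℝ] Euc m →L[ℝ] ℝ) : Euc m →L[ℝ] Euc m :=
  sharp b ∘L q

/-- The adjoint `A^*` of `A : T_xM → F` with respect to the inner product `b` on `T_xM` and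
that of `F`: `b (A^* w) v = ⟪w, A v⟫`. -/
noncomputable def adj {m : ℕ} {F : Type*} [NormedAddCommGroup F] [InnerProductSpace ℝ F]
    (b : Euc m →L[ℝ] Euc m →L[ℝ] ℝ) (A : Euc m →L[ℝ] F) : F →L[ℝ] Euc m :=
  sharp b ∘L (ContinuousLinearMap.compL ℝ (Euc m) F ℝ).flip A ∘L innerSL ℝ

/-- The component `k^{αβ} = (A^α)^* A^β` of the third fundamental form, as an endomorphism of
`T_xM`, for the sections `s = ν^α` and `t = ν^β` of `ν`. -/
noncomputable def thirdForm {m k n : ℕ} (g : FormField m) (ν : Euc m → Gr k n)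
    (s t : Euc m → Euc n) (x : Euc m) : Euc m →L[ℝ] Euc m :=
  adj (g x) (weingarten ν s x) ∘L weingarten ν t x

/-- The Christoffel map of `g`:
`2 g(Γ(v, w), z) = (∂_v g)(w, z) + (∂_w g)(v, z) - (∂_z g)(v, w)`. -/
noncomputable def christoffel {m : ℕ} (g : FormField m) (x v w : Euc m) : Euc m :=
  sharp (g x) ((1 / 2 : ℝ) •
    (fderiv ℝ g x v w + fderiv ℝ g x w v - ((fderiv ℝ g x).flip v).flip w))

/-- The Levi-Civita derivative `∇_v Y = ∂_v Y + Γ(v, Y)` of a vector field `Y` at `x`. -/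
noncomputable def leviCivita {m : ℕ} (g : FormField m) (Y : Euc m → Euc m) (x v : Euc m) :
    Euc m :=
  fderiv ℝ Y x v + christoffel g x v (Y x)

/-- The projection connection `∇_v s = (∂_v s)^T` on sections `s` of `ν^⊥`. -/
noncomputable def projConnection {m k n : ℕ} (ν : Euc m → Gr k n) (s : ∀ x, perp ν x)
    (x v : Euc m) : perp ν x :=
  (perp ν x).orthogonalProjectionOnto (fderiv ℝ (fun y => (s y : Euc n)) x v)

/-- A bundle map `TM → ν^⊥` composed with the inclusion of `ν^⊥` in `M × ℝ^n`. -/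
noncomputable def incl {m k n : ℕ} (ν : Euc m → Gr k n) (U : ∀ x, Euc m →L[ℝ] perp ν x)
    (x : Euc m) : Euc m →L[ℝ] Euc n :=
  (perp ν x).subtypeL ∘L U x

/-- `U : TM → ν^⊥` is parallel for the Levi-Civita connection on `TM` and the projection
connection on `ν^⊥`: `∇_v (U Y) = U (∇_v Y)` for all smooth vector fields `Y` on `M`. -/
def IsParallelOn {m k n : ℕ} (M : Set (Euc m)) (g : FormField m) (ν : Euc m → Gr k n)
    (U : ∀ x, Euc m →L[ℝ] perp ν x) : Prop :=
  ∀ Y : Euc m → Euc m, ContDiffOn ℝ ∞ Y M → ∀ x ∈ M, ∀ v : Euc m,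
    projConnection ν (fun y => U y (Y y)) x v = U x (leviCivita g Y x v)

/-- `u` is a smooth isometric immersion of `(M, g)` in `ℝ^n` whose normal space at every point
`x` is `ν x`. (It is an immersion because `g` is positive definite.) -/
structure IsSolution {m k n : ℕ} (M : Set (Euc m)) (g : FormField m) (ν : Euc m → Gr k n)
    (u : Euc m → Euc n) : Prop where
  smooth : ContDiffOn ℝ ∞ u M
  isometric : ∀ x ∈ M, ∀ v w, inner ℝ (fderiv ℝ u x v) (fderiv ℝ u x w) = g x v w
  gauss : ∀ x ∈ M, (LinearMap.range (fderiv ℝ u x).toLinearMap)ᗮ = (ν x).1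

/-- `(g, ν)` are the first fundamental form and the Gauss map of some immersion. -/
def IsAdmissible {m k n : ℕ} (M : Set (Euc m)) (g : FormField m) (ν : Euc m → Gr k n) : Prop :=
  ∃ u : Euc m → Euc n, IsSolution M g ν u

/-- `h^α` are smooth symmetric bilinear forms on `M` with `h^α h^β = k^{αβ}` (as endomorphisms),
and `U : TM → ν^⊥` is a smooth parallel bundle map with `h^α = -(A^α)^* U` for all `α`. -/
structure IsCompatible {m k n : ℕ} (M : Set (Euc m)) (g : FormField m) (ν : Euc m → Gr k n)
    (e : Fin k → Euc m → Euc n) (h : Fin k → FormField m)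
    (U : ∀ x, Euc m →L[ℝ] perp ν x) : Prop where
  h_smooth : ∀ α, ContDiffOn ℝ ∞ (h α) M
  h_symm : ∀ α, ∀ x ∈ M, ∀ v w, h α x v w = h α x w v
  h_mul : ∀ α β, ∀ x ∈ M,
    toEnd (g x) (h α x) ∘L toEnd (g x) (h β x) = thirdForm g ν (e α) (e β) x
  U_smooth : ContDiffOn ℝ ∞ (incl ν U) M
  h_eq : ∀ α, ∀ x ∈ M, toEnd (g x) (h α x) = -(adj (g x) (weingarten ν (e α) x) ∘L U x)
  U_parallel : IsParallelOn M g ν U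

end GaussMetric

/-! A parallel `U` is a closed `ℝ^n`-valued 1-form: the tangential part of its derivative is `U
(Γ(v, w))`, symmetric because `Γ` is torsion-free, and differentiating `⟪U w, ν^α⟫ = 0` shows that
the normal components are the symmetric forms `h^α` (`fderiv_incl_symm`). Simple connectedness then
gives `U = du`. The isometry is algebra at a point, for one index with `A` invertible: `h = -A^* U`
and `h h = A^* A` force `U h = -A`, hence `⟪U v, U h w⟫ = h(v, w) = g(v, h w)`, and `h` is onto
(`inner_map_map_eq`). Conversely, for an immersion the symmetric second derivative yields symmetric
`h^α`, and the Koszul formula makes `du` parallel (`proj_fderiv_fderiv`). -/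

namespace GaussMetric

open Filter Topology Set

/-! ### Primitives of closed forms by covering spaces -/

/-- A type with its discrete topology. -/
def Discrete (G : Type*) : Type _ := G

instance (G : Type*) : TopologicalSpace (Discrete G) := ⊥
instance (G : Type*) : DiscreteTopology (Discrete G) := ⟨rfl⟩

/-- The point of `G` underlying a point of `Discrete G`. -/
def Discrete.val {G : Type*} (v : Discrete G) : G := v

/-- A point of `G` as a point of `Discrete G`. -/
def Discrete.mk {G : Type*} (v : G) : Discrete G := v

/-- The covering whose sections are the functions that differ from each `f i` by a locally
constant function on the neighbourhood `B i`. -/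
def primitiveCore {ι X G : Type*} [TopologicalSpace X] [AddCommGroup G]
    (B : ι → Set X) (hB : ∀ i, IsOpen (B i)) (ix : X → ι) (hix : ∀ x, x ∈ B (ix x))
    (f : ι → X → G)
    (hf : ∀ i j, ∀ x ∈ B i ∩ B j, ∀ᶠ y in 𝓝 x, f i y - f j y = f i x - f j x) :
    FiberBundleCore ι X (Discrete G) where
  baseSet := B
  isOpen_baseSet := hB
  indexAt := ix
  mem_baseSet_at := hix
  coordChange i j x v := .mk (f i x - f j x + v.val)
  coordChange_self i x _ v := by
    rw [sub_self, zero_add]; rfl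
  continuousOn_coordChange i j := by
    rintro ⟨x, v⟩ ⟨hx, -⟩
    refine ContinuousAt.continuousWithinAt ?_
    rw [ContinuousAt, nhds_discrete (Discrete G), tendsto_pure, nhds_prod_eq,
      nhds_discrete (Discrete G)]
    have h2 : ∀ᶠ w in pure v, w = v := by simp
    filter_upwards [(hf i j x hx).prod_mk h2] with p hp
    obtain ⟨h1, h2⟩ := hp
    simp only [h1, h2]
  coordChange_comp i j k x _ v := by
    refine congrArg Discrete.mk ?_
    change (f j x - f k x) + ((f i x - f j x) + v.val) = (f i x - f k x) + v.val
    abel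

/-- On a simply connected space, local functions that agree up to locally constant functions
can be glued up to locally constant functions. -/
theorem exists_glue_of_locally_const {ι X G : Type*} [TopologicalSpace X] [AddCommGroup G]
    [SimplyConnectedSpace X] [LocallyPathConnectedSpace X]
    (B : ι → Set X) (hB : ∀ i, IsOpen (B i)) (ix : X → ι) (hix : ∀ x, x ∈ B (ix x))
    (f : ι → X → G)
    (hf : ∀ i j, ∀ x ∈ B i ∩ B j, ∀ᶠ y in 𝓝 x, f i y - f j y = f i x - f j x) :
    ∃ u : X → G, ∀ i, ∀ x ∈ B i, ∀ᶠ y in 𝓝 x, u y - f i y = u x - f i x := by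
  let Z := primitiveCore B hB ix hix f hf
  have cov : IsCoveringMap (Bundle.TotalSpace.proj : Bundle.TotalSpace (Discrete G) Z.Fiber → X) :=
    FiberBundle.isCoveringMap
  obtain ⟨x₀⟩ : Nonempty X := inferInstance
  -- A lift of the identity through the covering is a global section.
  obtain ⟨s, ⟨-, hs⟩, -⟩ := cov.existsUnique_continuousMap_lifts (ContinuousMap.id X) x₀
    ⟨x₀, Discrete.mk (0 : G)⟩ rfl
  have hs' : ∀ x, (s x).proj = x := fun x => congrFun hs x
  refine ⟨fun x => f (ix x) x + Discrete.val (s x).2, fun i x hx => ?_⟩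
  have hc : ContinuousAt (fun y => (Z.localTriv i (s y)).2) x := by
    have h1 : ContinuousAt (Z.localTriv i) (s x) := by
      apply (Z.localTriv i).continuousAt
      rw [Z.mem_localTriv_source]
      change (s x).proj ∈ B i
      rwa [hs']
    exact continuous_snd.continuousAt.comp (h1.comp s.continuous.continuousAt)
  rw [ContinuousAt, nhds_discrete (Discrete G), tendsto_pure] at hc
  -- The difference `u - f i` is the section read in chart `i`: continuous into a discrete space, so
  -- locally constant.
  have key : ∀ y, f (ix y) y + Discrete.val (s y).2 - f i y =
      Discrete.val (Z.localTriv i (s y)).2 := by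
    intro y
    have : Discrete.val (Z.localTriv i (s y)).2
      = f (ix (s y).proj) (s y).proj - f i (s y).proj + Discrete.val (s y).2 := rfl
    rw [this, hs']
    abel
  filter_upwards [hc] with y hy
  rw [key, key]
  exact congrArg Discrete.val hy

/-- The Poincaré lemma for `1`-forms on a simply connected open set. -/
theorem exists_forall_hasFDerivAt_of_simplyConnected {E F : Type*}
    [NormedAddCommGroup E] [NormedSpace ℝ E] [NormedAddCommGroup F] [NormedSpace ℝ F]
    [CompleteSpace F] {s : Set E} (hs : IsOpen s) [SimplyConnectedSpace s] {η : E → E →L[ℝ] F}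
    (hη : DifferentiableOn ℝ η s)
    (hdη : ∀ a ∈ s, ∀ x y, fderiv ℝ η a x y = fderiv ℝ η a y x) :
    ∃ f, ∀ a ∈ s, HasFDerivAt f (η a) a := by
  classical
  have : LocallyPathConnectedSpace s := hs.locallyPathConnectedSpace
  have hr : ∀ x : s, ∃ r > 0, Metric.ball (x : E) r ⊆ s := fun x => Metric.isOpen_iff.1 hs x x.2
  choose r hr0 hrs using hr
  have hp : ∀ i : s, ∃ f, ∀ a ∈ Metric.ball (i : E) (r i), HasFDerivAt f (η a) a := fun i =>
    (convex_ball (i : E) (r i)).exists_forall_hasFDerivAt_of_fderiv_symmetric Metric.isOpen_ball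
      (hη.mono (hrs i)) fun a ha => hdη a (hrs i ha)
  choose p hp using hp
  obtain ⟨u, hu⟩ := exists_glue_of_locally_const (X := s) (G := F)
    (fun i : s => Subtype.val ⁻¹' Metric.ball (i : E) (r i))
    (fun i => Metric.isOpen_ball.preimage continuous_subtype_val) id
    (fun x => Metric.mem_ball_self (hr0 x)) (fun i x => p i x) (by
      rintro i j x ⟨hi, hj⟩
      have ho : IsOpen (Metric.ball (i : E) (r i) ∩ Metric.ball (j : E) (r j)) :=
        Metric.isOpen_ball.inter Metric.isOpen_ball
      have hc : Convex ℝ (Metric.ball (i : E) (r i) ∩ Metric.ball (j : E) (r j)) :=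
        (convex_ball _ _).inter (convex_ball _ _)
      have hd : ∀ a ∈ Metric.ball (i : E) (r i) ∩ Metric.ball (j : E) (r j),
          HasFDerivAt (fun y => p i y - p j y) (0 : E →L[ℝ] F) a := fun a ha => by
        have h := (hp i a ha.1).sub (hp j a ha.2)
        rw [sub_self] at h
        exact h
      have hn := continuous_subtype_val.continuousAt.preimage_mem_nhds
        (x := x) (ho.mem_nhds ⟨hi, hj⟩)
      filter_upwards [hn] with y hy
      -- Two primitives differ by a constant on the intersection of two balls, which is convex and
      -- hence connected.
      exact ho.is_const_of_fderiv_eq_zero hc.isPreconnected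
        (fun a ha => (hd a ha).differentiableAt.differentiableWithinAt)
        (fun a ha => (hd a ha).fderiv) hy ⟨hi, hj⟩)
  refine ⟨fun x => if hx : x ∈ s then u ⟨x, hx⟩ else 0, fun a ha => ?_⟩
  have h1 := hu ⟨a, ha⟩ ⟨a, ha⟩ (Metric.mem_ball_self (hr0 _))
  have h2 := hp ⟨a, ha⟩ a (Metric.mem_ball_self (hr0 _))
  refine (h2.add_const (u ⟨a, ha⟩ - p ⟨a, ha⟩ a)).congr_of_eventuallyEq ?_
  rw [nhds_subtype_eq_comap, eventually_comap] at h1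
  filter_upwards [h1, hs.mem_nhds ha] with y hy hys
  have := hy ⟨y, hys⟩ rfl
  rw [dif_pos hys, ← this]
  abel

/-! ### Pointwise algebra of `h`, `A` and `U` -/

section LinearAlgebra

variable {m : ℕ} {b : Euc m →L[ℝ] Euc m →L[ℝ] ℝ}

theorem isInvertible_of_pos (hb : ∀ v, v ≠ 0 → 0 < b v v) : b.IsInvertible := by
  have hinj : Function.Injective b.toLinearMap := by
    rw [injective_iff_map_eq_zero]
    intro v hv
    by_contra hne
    have := hb v hne
    rw [show b v = 0 from hv] at this
    simp at this
  have hdim : Module.finrank ℝ (Euc m) = Module.finrank ℝ (Euc m →L[ℝ] ℝ) :=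
    (InnerProductSpace.toDual ℝ (Euc m)).toLinearEquiv.finrank_eq
  exact ⟨(LinearEquiv.ofInjectiveOfFinrankEq b.toLinearMap hinj hdim).toContinuousLinearEquiv, rfl⟩

theorem apply_sharp (hb : ∀ v, v ≠ 0 → 0 < b v v) (φ : Euc m →L[ℝ] ℝ) : b (sharp b φ) = φ :=
  ((isInvertible_of_pos hb).inverse_apply_eq.1 rfl).symm

theorem eq_of_forall_apply_eq (hb : ∀ v, v ≠ 0 → 0 < b v v) {v w : Euc m}
    (h : ∀ z, b v z = b w z) : v = w := by
  by_contra hne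
  have := hb (v - w) (sub_ne_zero.2 hne)
  simp [h] at this

theorem apply_toEnd (hb : ∀ v, v ≠ 0 → 0 < b v v) (q : Euc m →L[ℝ] Euc m →L[ℝ] ℝ) (v w : Euc m) :
    b (toEnd b q v) w = q v w := by
  simp [toEnd, apply_sharp hb]

variable {F : Type*} [NormedAddCommGroup F] [InnerProductSpace ℝ F]

theorem apply_adj (hb : ∀ v, v ≠ 0 → 0 < b v v) (A : Euc m →L[ℝ] F) (z : F) (w : Euc m) :
    b (adj b A z) w = inner ℝ z (A w) := by
  simp only [adj, ContinuousLinearMap.comp_apply, apply_sharp hb]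
  rfl

variable {q : Euc m →L[ℝ] Euc m →L[ℝ] ℝ} {A U : Euc m →L[ℝ] F}

theorem toEnd_eq_neg_adj_comp_iff (hb : ∀ v, v ≠ 0 → 0 < b v v) :
    toEnd b q = -(adj b A ∘L U) ↔ ∀ v w, q v w = -inner ℝ (U v) (A w) := by
  constructor
  · intro h v w
    rw [← apply_toEnd hb q, h]
    simp [apply_adj hb]
  · intro h
    ext1 v
    refine eq_of_forall_apply_eq hb fun w => ?_
    simp [apply_toEnd hb, apply_adj hb, h]

/-- Pairing `h h = A^* A` with `w` gives `-⟪U h v, A w⟫ = ⟪A v, A w⟫`; surjectivity of `A` cancels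
`A w`. -/
theorem map_toEnd_eq_neg (hb : ∀ v, v ≠ 0 → 0 < b v v) (hA : Function.Surjective A)
    (hq : ∀ v w, q v w = -inner ℝ (U v) (A w))
    (hqq : toEnd b q ∘L toEnd b q = adj b A ∘L A) (v : Euc m) : U (toEnd b q v) = -A v := by
  refine ext_inner_right ℝ fun z => ?_
  obtain ⟨w, rfl⟩ := hA z
  have h := congrArg (fun v => b v w) (congrArg (fun T => T v) hqq)
  simp only [ContinuousLinearMap.comp_apply, apply_toEnd hb, apply_adj hb] at h
  rw [hq] at h
  rw [inner_neg_left, ← h, neg_neg]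

theorem inner_map_map_eq (hb : ∀ v, v ≠ 0 → 0 < b v v) (hb' : ∀ v w, b v w = b w v)
    (hA : Function.Bijective A) (hq : ∀ v w, q v w = -inner ℝ (U v) (A w))
    (hq' : ∀ v w, q v w = q w v)
    (hqq : toEnd b q ∘L toEnd b q = adj b A ∘L A) (v w : Euc m) :
    inner ℝ (U v) (U w) = b v w := by
  have hU := map_toEnd_eq_neg hb hA.2 hq hqq
  have hinj : Function.Injective (toEnd b q).toLinearMap := by
    rw [injective_iff_map_eq_zero]
    intro v hv
    have h := hU v
    rw [show toEnd b q v = 0 from hv, map_zero, zero_eq_neg] at h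
    exact hA.1 (h.trans (map_zero A).symm)
  -- By `U h = -A`, the kernel of `h` lies in that of `A`, so `h` is onto in finite dimension and
  -- `w` may be replaced by `h w`.
  obtain ⟨w, rfl⟩ := LinearMap.injective_iff_surjective.1 hinj w
  change inner ℝ (U v) (U (toEnd b q w)) = b v (toEnd b q w)
  rw [hU, inner_neg_right, ← hq, hq', hb', apply_toEnd hb]

end LinearAlgebra

/-! ### Frames, metric derivatives and Christoffel symbols -/

section Calculus

variable {m n k : ℕ} {M : Set (Euc m)} {g : FormField m} {ν : Euc m → Gr k n}
  {e : Fin k → Euc m → Euc n}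

theorem IsOrthonormalFrameOn.mem (he : IsOrthonormalFrameOn M ν e) (α : Fin k) {x : Euc m}
    (hx : x ∈ M) : e α x ∈ (ν x).1 := by
  rw [← he.span x hx]
  exact Submodule.subset_span ⟨α, rfl⟩

theorem IsOrthonormalFrameOn.inner_eq_zero (he : IsOrthonormalFrameOn M ν e) (α : Fin k)
    {x : Euc m} (hx : x ∈ M) (z : perp ν x) : inner ℝ (z : Euc n) (e α x) = 0 :=
  Submodule.inner_left_of_mem_orthogonal (he.mem α hx) z.2

/-- Such a `z` lies in both `ν^⊥` and `ν^⊥⊥`, so it is orthogonal to itself. Closedness of `U` can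
thus be checked on normal and tangential parts separately. -/
theorem IsOrthonormalFrameOn.eq_zero (he : IsOrthonormalFrameOn M ν e) {x : Euc m}
    (hx : x ∈ M) {z : Euc n} (h : ∀ α, inner ℝ z (e α x) = 0)
    (h' : (perp ν x).orthogonalProjectionOnto z = 0) : z = 0 := by
  have h1 : z ∈ (ν x).1ᗮᗮ := Submodule.orthogonalProjectionOnto_eq_zero_iff.1 h'
  have h2 : z ∈ (ν x).1ᗮ := by
    rw [← he.span x hx, Submodule.mem_orthogonal']
    intro y hy
    induction hy using Submodule.span_induction with
    | mem y hy => obtain ⟨α, rfl⟩ := hy; exact h α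
    | zero => simp
    | add a b _ _ ha hb => rw [inner_add_right, ha, hb, add_zero]
    | smul c a _ ha => rw [inner_smul_right, ha, mul_zero]
  exact inner_self_eq_zero.1 ((Submodule.mem_orthogonal _ _).1 h1 z h2)

theorem inner_weingarten (s : Euc m → Euc n) (x : Euc m) (z : perp ν x) (w : Euc m) :
    inner ℝ z (weingarten ν s x w) = inner ℝ (z : Euc n) (fderiv ℝ s x w) :=
  Submodule.inner_orthogonalProjectionOnto_eq_of_mem_left z _

/-- If `W` takes values in `ν^⊥`, then the normal part of its derivative is given by the
derivative of the frame. -/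
theorem inner_fderiv_frame (hM : IsOpen M) (he : IsOrthonormalFrameOn M ν e)
    {W : Euc m → Euc m →L[ℝ] Euc n} (hW : DifferentiableOn ℝ W M)
    (hWν : ∀ x ∈ M, ∀ v, W x v ∈ perp ν x) (α : Fin k) {x : Euc m} (hx : x ∈ M) (v w : Euc m) :
    inner ℝ (fderiv ℝ W x v w) (e α x) = -inner ℝ (W x w) (fderiv ℝ (e α) x v) := by
  have h1 : HasFDerivAt (fun y => W y w) ((fderiv ℝ W x).flip w) x := by
    simpa using (hW.differentiableAt (hM.mem_nhds hx)).hasFDerivAt.clm_apply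
      (hasFDerivAt_const w x)
  have h2 : HasFDerivAt (e α) (fderiv ℝ (e α) x) x :=
    (((he.smooth α).contDiffAt (hM.mem_nhds hx)).differentiableAt (by simp)).hasFDerivAt
  have h3 := (h1.inner ℝ h2).unique ((hasFDerivAt_const (0 : ℝ) x).congr_of_eventuallyEq (by
    filter_upwards [hM.mem_nhds hx] with y hy
    exact he.inner_eq_zero α hy ⟨_, hWν y hy w⟩))
  have h4 := congrArg (fun T => T v) h3
  simp at h4
  linarith

theorem fderiv_metric_apply (hM : IsOpen M) (hg : IsRiemannianMetricOn M g) {x : Euc m}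
    (hx : x ∈ M) (w z : Euc m) :
    HasFDerivAt (fun y => g y w z) (((fderiv ℝ g x).flip w).flip z) x := by
  have h := ((hg.smooth.contDiffAt (hM.mem_nhds hx)).differentiableAt (by simp)).hasFDerivAt
  simpa using (h.clm_apply (hasFDerivAt_const w x)).clm_apply (hasFDerivAt_const z x)

theorem fderiv_metric_symm (hM : IsOpen M) (hg : IsRiemannianMetricOn M g) {x : Euc m}
    (hx : x ∈ M) (v w z : Euc m) : fderiv ℝ g x v w z = fderiv ℝ g x v z w := by
  have h := (fderiv_metric_apply hM hg hx w z).unique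
    ((fderiv_metric_apply hM hg hx z w).congr_of_eventuallyEq (by
      filter_upwards [hM.mem_nhds hx] with y hy
      exact hg.symm y hy w z))
  exact congrArg (fun T => T v) h

theorem metric_christoffel (hg : IsRiemannianMetricOn M g) {x : Euc m} (hx : x ∈ M)
    (v w z : Euc m) : g x (christoffel g x v w) z =
      1 / 2 * (fderiv ℝ g x v w z + fderiv ℝ g x w v z - fderiv ℝ g x z v w) := by
  simp [christoffel, apply_sharp (hg.pos x hx)]

theorem christoffel_symm (hM : IsOpen M) (hg : IsRiemannianMetricOn M g) {x : Euc m}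
    (hx : x ∈ M) (v w : Euc m) : christoffel g x v w = christoffel g x w v := by
  refine eq_of_forall_apply_eq (hg.pos x hx) fun z => ?_
  rw [metric_christoffel hg hx, metric_christoffel hg hx, fderiv_metric_symm hM hg hx z v w]
  ring

end Calculus

variable {m n k : ℕ} {M : Set (Euc m)} {g : FormField m} {ν : Euc m → Gr k n}
  {e : Fin k → Euc m → Euc n}

/-! ### From an immersion to compatible data -/

section OfSolution

variable {u : Euc m → Euc n}

/-- The differential of a map to `ℝ^n`, projected to `ν^⊥`. -/
noncomputable def tangentMap (ν : Euc m → Gr k n) (u : Euc m → Euc n) (x : Euc m) :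
    Euc m →L[ℝ] perp ν x :=
  (perp ν x).orthogonalProjectionOnto ∘L fderiv ℝ u x

/-- The second fundamental form of `u` in the direction of the normal field `s`. -/
noncomputable def secondForm (u s : Euc m → Euc n) : FormField m := fun x =>
  -(innerSL ℝ).bilinearComp (fderiv ℝ u x) (fderiv ℝ s x)

theorem secondForm_apply (u s : Euc m → Euc n) (x v w : Euc m) :
    secondForm u s x v w = -inner ℝ (fderiv ℝ u x v) (fderiv ℝ s x w) := rfl

theorem IsSolution.range_eq (hu : IsSolution M g ν u) {x : Euc m} (hx : x ∈ M) :
    LinearMap.range (fderiv ℝ u x).toLinearMap = perp ν x := by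
  rw [perp, ← hu.gauss x hx, Submodule.orthogonal_orthogonal]

theorem IsSolution.fderiv_mem (hu : IsSolution M g ν u) {x : Euc m} (hx : x ∈ M) (v : Euc m) :
    fderiv ℝ u x v ∈ perp ν x := by
  rw [← hu.range_eq hx]
  exact ⟨v, rfl⟩

/-- On `M` the projection changes nothing; it only supplies values in `ν^⊥` at points outside `M`.
-/
theorem IsSolution.coe_tangentMap (hu : IsSolution M g ν u) {x : Euc m} (hx : x ∈ M)
    (v : Euc m) : (tangentMap ν u x v : Euc n) = fderiv ℝ u x v :=
  Submodule.starProjection_eq_self_iff.2 (hu.fderiv_mem hx v)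

theorem IsSolution.incl_tangentMap (hu : IsSolution M g ν u) {x : Euc m} (hx : x ∈ M) :
    incl ν (tangentMap ν u) x = fderiv ℝ u x := by
  ext1 v
  exact hu.coe_tangentMap hx v

theorem IsSolution.tangentMap_surjective (hu : IsSolution M g ν u) {x : Euc m} (hx : x ∈ M) :
    Function.Surjective (tangentMap ν u x) := by
  rintro ⟨z, hz⟩
  rw [← hu.range_eq hx] at hz
  obtain ⟨v, rfl⟩ := hz
  exact ⟨v, Subtype.ext (hu.coe_tangentMap hx v)⟩

theorem IsSolution.inner_tangentMap (hu : IsSolution M g ν u) {x : Euc m} (hx : x ∈ M)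
    (v : Euc m) (z : Euc n) :
    inner ℝ (fderiv ℝ u x v) ((perp ν x).orthogonalProjectionOnto z : Euc n)
      = inner ℝ (fderiv ℝ u x v) z :=
  Submodule.inner_orthogonalProjectionOnto_eq_of_mem_left ⟨_, hu.fderiv_mem hx v⟩ z

theorem IsSolution.fderiv_smooth (hM : IsOpen M) (hu : IsSolution M g ν u) :
    ContDiffOn ℝ ∞ (fderiv ℝ u) M :=
  hu.smooth.fderiv_of_isOpen hM (by simp)

theorem IsSolution.fderiv_fderiv_symm (hM : IsOpen M) (hu : IsSolution M g ν u) {x : Euc m}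
    (hx : x ∈ M) (v w : Euc m) :
    fderiv ℝ (fderiv ℝ u) x v w = fderiv ℝ (fderiv ℝ u) x w v :=
  ((hu.smooth.contDiffAt (hM.mem_nhds hx)).isSymmSndFDerivAt (by
    rw [minSmoothness_of_isRCLikeNormedField]
    exact WithTop.coe_le_coe.2 le_top)) v w

theorem IsSolution.hasFDerivAt_fderiv (hM : IsOpen M) (hu : IsSolution M g ν u) {x : Euc m}
    (hx : x ∈ M) : HasFDerivAt (fderiv ℝ u) (fderiv ℝ (fderiv ℝ u) x) x :=
  (((hu.fderiv_smooth hM).contDiffAt (hM.mem_nhds hx)).differentiableAt (by simp)).hasFDerivAt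

theorem IsSolution.secondForm_symm (hM : IsOpen M) (he : IsOrthonormalFrameOn M ν e)
    (hu : IsSolution M g ν u) (α : Fin k) {x : Euc m} (hx : x ∈ M) (v w : Euc m) :
    secondForm u (e α) x v w = secondForm u (e α) x w v := by
  have h := inner_fderiv_frame hM he ((hu.fderiv_smooth hM).differentiableOn (by simp))
    (fun x hx => hu.fderiv_mem hx) α hx
  rw [secondForm_apply, secondForm_apply, ← h, ← h, hu.fderiv_fderiv_symm hM hx]

/-- Differentiating the isometry condition. -/
theorem IsSolution.fderiv_metric (hM : IsOpen M) (hg : IsRiemannianMetricOn M g)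
    (hu : IsSolution M g ν u) {x : Euc m} (hx : x ∈ M) (v w z : Euc m) :
    fderiv ℝ g x v w z = inner ℝ (fderiv ℝ u x w) (fderiv ℝ (fderiv ℝ u) x v z)
      + inner ℝ (fderiv ℝ (fderiv ℝ u) x v w) (fderiv ℝ u x z) := by
  have h1 (w : Euc m) : HasFDerivAt (fun y => fderiv ℝ u y w)
      ((fderiv ℝ (fderiv ℝ u) x).flip w) x := by
    simpa using (hu.hasFDerivAt_fderiv hM hx).clm_apply (hasFDerivAt_const w x)
  have h2 := (fderiv_metric_apply hM hg hx w z).unique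
    (((h1 w).inner ℝ (h1 z)).congr_of_eventuallyEq (by
      filter_upwards [hM.mem_nhds hx] with y hy
      exact (hu.isometric y hy w z).symm))
  have h3 := congrArg (fun T => T v) h2
  simpa using h3

/-- Koszul formula: tested against `du z`, the three metric derivatives become six terms in the
second derivative of `u`; by its symmetry four cancel and two coincide. -/
theorem IsSolution.proj_fderiv_fderiv (hM : IsOpen M) (hg : IsRiemannianMetricOn M g)
    (hu : IsSolution M g ν u) {x : Euc m} (hx : x ∈ M) (v w : Euc m) :
    (perp ν x).orthogonalProjectionOnto (fderiv ℝ (fderiv ℝ u) x v w) =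
      tangentMap ν u x (christoffel g x v w) := by
  refine ext_inner_left ℝ fun z => ?_
  obtain ⟨z, rfl⟩ := hu.tangentMap_surjective hx z
  rw [Submodule.coe_inner, Submodule.coe_inner, hu.coe_tangentMap hx, hu.coe_tangentMap hx,
    hu.inner_tangentMap hx, hu.isometric x hx, hg.symm x hx, metric_christoffel hg hx,
    hu.fderiv_metric hM hg hx, hu.fderiv_metric hM hg hx, hu.fderiv_metric hM hg hx,
    hu.fderiv_fderiv_symm hM hx w v, hu.fderiv_fderiv_symm hM hx z v,
    hu.fderiv_fderiv_symm hM hx z w,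
    real_inner_comm (fderiv ℝ u x z), real_inner_comm (fderiv ℝ u x w)]
  ring

theorem IsSolution.tangentMap_parallel (hM : IsOpen M) (hg : IsRiemannianMetricOn M g)
    (hu : IsSolution M g ν u) : IsParallelOn M g ν (tangentMap ν u) := by
  intro Y hY x hx v
  have hY' := ((hY.contDiffAt (hM.mem_nhds hx)).differentiableAt (by simp)).hasFDerivAt
  have h := (((hu.hasFDerivAt_fderiv hM hx).clm_apply hY').congr_of_eventuallyEq
    (f₁ := fun y => (tangentMap ν u y (Y y) : Euc n)) (by
      filter_upwards [hM.mem_nhds hx] with y hy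
      exact hu.coe_tangentMap hy (Y y))).fderiv
  rw [projConnection, h, leviCivita, map_add, ← hu.proj_fderiv_fderiv hM hg hx]
  simp only [add_apply, ContinuousLinearMap.comp_apply, map_add, ContinuousLinearMap.flip_apply]
  rfl

theorem IsSolution.isCompatible (hM : IsOpen M) (hg : IsRiemannianMetricOn M g)
    (he : IsOrthonormalFrameOn M ν e) (hu : IsSolution M g ν u) :
    IsCompatible M g ν e (fun α => secondForm u (e α)) (tangentMap ν u) := by
  have hq (α : Fin k) {x : Euc m} (hx : x ∈ M) (v w : Euc m) : secondForm u (e α) x v w =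
      -inner ℝ (tangentMap ν u x v) (weingarten ν (e α) x w) := by
    rw [inner_weingarten, hu.coe_tangentMap hx, secondForm_apply]
  refine ⟨fun α => ?_, fun α x hx => hu.secondForm_symm hM he α hx, fun α β x hx => ?_, ?_,
    fun α x hx => (toEnd_eq_neg_adj_comp_iff (hg.pos x hx)).2 (hq α hx),
    hu.tangentMap_parallel hM hg⟩
  · have h1 := (he.smooth α).fderiv_of_isOpen (m := ∞) hM (by simp)
    refine contDiffOn_clm_apply.2 fun v => contDiffOn_clm_apply.2 fun w => ?_
    exact (((hu.fderiv_smooth hM).clm_apply contDiffOn_const).inner ℝ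
      (h1.clm_apply contDiffOn_const)).neg
  · have hb := hg.pos x hx
    ext1 v
    refine eq_of_forall_apply_eq hb fun w => ?_
    -- Again `U h = -A`, now obtained from the isometry and surjectivity of `U`, so no invertibility
    -- of `A` is needed.
    have h1 : tangentMap ν u x (toEnd (g x) (secondForm u (e β) x) v) =
        -weingarten ν (e β) x v := by
      refine ext_inner_right ℝ fun z => ?_
      obtain ⟨z, rfl⟩ := hu.tangentMap_surjective hx z
      rw [inner_neg_left, real_inner_comm _ (weingarten ν (e β) x v), ← hq β hx, hu.secondForm_symm hM he β hx,
        Submodule.coe_inner, hu.coe_tangentMap hx, hu.coe_tangentMap hx, hu.isometric x hx,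
        apply_toEnd hb]
    rw [ContinuousLinearMap.comp_apply, apply_toEnd hb, hq α hx, h1, thirdForm,
      ContinuousLinearMap.comp_apply, apply_adj hb, inner_neg_left, neg_neg]
  · exact (hu.fderiv_smooth hM).congr fun x hx => hu.incl_tangentMap hx

theorem IsSolution.hasFDerivAt (hM : IsOpen M) (hu : IsSolution M g ν u) {x : Euc m}
    (hx : x ∈ M) : HasFDerivAt u (incl ν (tangentMap ν u) x) x := by
  rw [hu.incl_tangentMap hx]
  exact ((hu.smooth.contDiffAt (hM.mem_nhds hx)).differentiableAt (by simp)).hasFDerivAt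

end OfSolution

/-! ### From compatible data to an immersion -/

section OfCompatible

variable {h : Fin k → FormField m} {U : ∀ x, Euc m →L[ℝ] perp ν x}

theorem IsCompatible.form_apply (hg : IsRiemannianMetricOn M g)
    (hU : IsCompatible M g ν e h U) (α : Fin k) {x : Euc m} (hx : x ∈ M) (v w : Euc m) :
    h α x v w = -inner ℝ (U x v) (weingarten ν (e α) x w) :=
  (toEnd_eq_neg_adj_comp_iff (hg.pos x hx)).1 (hU.h_eq α x hx) v w

/-- The `ℝ^n`-valued `1`-form `U` is closed. -/
theorem IsCompatible.fderiv_incl_symm (hM : IsOpen M) (hg : IsRiemannianMetricOn M g)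
    (he : IsOrthonormalFrameOn M ν e) (hU : IsCompatible M g ν e h U) {x : Euc m} (hx : x ∈ M)
    (v w : Euc m) : fderiv ℝ (incl ν U) x v w = fderiv ℝ (incl ν U) x w v := by
  have hd : DifferentiableOn ℝ (incl ν U) M := hU.U_smooth.differentiableOn (by simp)
  have hp (v w : Euc m) : (perp ν x).orthogonalProjectionOnto (fderiv ℝ (incl ν U) x v w) =
      U x (christoffel g x v w) := by
    -- For a constant field the Levi-Civita derivative is just the Christoffel term.
    have h1 := hU.U_parallel (fun _ => w) contDiffOn_const x hx v
    have h2 : HasFDerivAt (fun y => incl ν U y w) ((fderiv ℝ (incl ν U) x).flip w) x := by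
      simpa using (hd.differentiableAt (hM.mem_nhds hx)).hasFDerivAt.clm_apply
        (hasFDerivAt_const w x)
    rw [projConnection, HasFDerivAt.fderiv (f := fun y => (U y w : Euc n)) h2] at h1
    simpa [leviCivita] using h1
  have hn (α : Fin k) (v w : Euc m) :
      inner ℝ (fderiv ℝ (incl ν U) x v w) (e α x) = h α x w v := by
    rw [inner_fderiv_frame hM he hd (fun x _ v => (U x v).2) α hx, hU.form_apply hg α hx,
      inner_weingarten]
    rfl
  refine sub_eq_zero.1 (he.eq_zero hx (fun α => ?_) ?_)
  · rw [inner_sub_left, hn, hn, hU.h_symm α x hx, sub_self]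
  · rw [map_sub, hp, hp, christoffel_symm hM hg hx, sub_self]

theorem IsCompatible.isSolution (hM : IsOpen M) (hg : IsRiemannianMetricOn M g)
    (hA : ∃ α, ∀ x ∈ M, Function.Bijective (weingarten ν (e α) x))
    (hU : IsCompatible M g ν e h U) {u : Euc m → Euc n}
    (hu : ∀ x ∈ M, HasFDerivAt u (incl ν U x) x) : IsSolution M g ν u := by
  obtain ⟨α, hA⟩ := hA
  refine ⟨(contDiffOn_infty_iff_fderiv_of_isOpen hM).2
    ⟨fun x hx => (hu x hx).differentiableAt.differentiableWithinAt,
      hU.U_smooth.congr fun x hx => (hu x hx).fderiv⟩, fun x hx v w => ?_, fun x hx => ?_⟩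
  · rw [(hu x hx).fderiv]
    exact inner_map_map_eq (hg.pos x hx) (hg.symm x hx) (hA x hx) (hU.form_apply hg α hx)
      (hU.h_symm α x hx) (hU.h_mul α α x hx) v w
  · have hs : LinearMap.range (fderiv ℝ u x).toLinearMap = perp ν x := by
      rw [(hu x hx).fderiv]
      refine le_antisymm (by rintro _ ⟨v, rfl⟩; exact (U x v).2) fun z hz => ?_
      obtain ⟨v, hv⟩ := (hA x hx).2 ⟨z, hz⟩
      -- Since `U h = -A`, the preimage of `z = A v` under `U` is `-h v`.
      refine ⟨-toEnd (g x) (h α x) v, ?_⟩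
      have h1 := map_toEnd_eq_neg (hg.pos x hx) (hA x hx).2 (hU.form_apply hg α hx)
        (hU.h_mul α α x hx) v
      change (U x (-toEnd (g x) (h α x) v) : Euc n) = z
      rw [map_neg, h1, neg_neg, hv]
    rw [hs, perp, Submodule.orthogonal_orthogonal]

end OfCompatible

end GaussMetric

/-! ### Equivalence, and uniqueness up to translation -/

theorem theorem4 (m n : ℕ) (hmn : m ≤ n)
    (M : Set (GaussMetric.Euc m)) (hM : IsOpen M) (hM' : SimplyConnectedSpace M)
    (g : GaussMetric.FormField m) (hg : GaussMetric.IsRiemannianMetricOn M g)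
    (ν : GaussMetric.Euc m → GaussMetric.Gr (n - m) n) (hν : GaussMetric.IsSmoothGrOn M ν)
    (e : Fin (n - m) → GaussMetric.Euc m → GaussMetric.Euc n)
    (he : GaussMetric.IsOrthonormalFrameOn M ν e)
    (hA : ∃ α, ∀ x ∈ M, Function.Bijective (GaussMetric.weingarten ν (e α) x)) :
    (GaussMetric.IsAdmissible M g ν ↔
      ∃ (h : Fin (n - m) → GaussMetric.FormField m)
        (U : ∀ x, GaussMetric.Euc m →L[ℝ] GaussMetric.perp ν x),
        GaussMetric.IsCompatible M g ν e h U) ∧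
    (∀ (h : Fin (n - m) → GaussMetric.FormField m)
      (U : ∀ x, GaussMetric.Euc m →L[ℝ] GaussMetric.perp ν x),
      GaussMetric.IsCompatible M g ν e h U →
      ∃ u : GaussMetric.Euc m → GaussMetric.Euc n,
        GaussMetric.IsSolution M g ν u ∧
        (∀ x ∈ M, HasFDerivAt u (GaussMetric.incl ν U x) x) ∧
        ∀ u' : GaussMetric.Euc m → GaussMetric.Euc n,
          (∀ x ∈ M, HasFDerivAt u' (GaussMetric.incl ν U x) x) →
          ∃ c : GaussMetric.Euc n, ∀ x ∈ M, u' x = u x + c) ∧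
    (∀ u : GaussMetric.Euc m → GaussMetric.Euc n, GaussMetric.IsSolution M g ν u →
      ∃ (h : Fin (n - m) → GaussMetric.FormField m)
        (U : ∀ x, GaussMetric.Euc m →L[ℝ] GaussMetric.perp ν x),
        GaussMetric.IsCompatible M g ν e h U ∧
        ∀ x ∈ M, HasFDerivAt u (GaussMetric.incl ν U x) x) := by
  have hcs : ∀ (h : Fin (n - m) → GaussMetric.FormField m)
      (U : ∀ x, GaussMetric.Euc m →L[ℝ] GaussMetric.perp ν x),
      GaussMetric.IsCompatible M g ν e h U →
      ∃ u : GaussMetric.Euc m → GaussMetric.Euc n,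
        GaussMetric.IsSolution M g ν u ∧
        ∀ x ∈ M, HasFDerivAt u (GaussMetric.incl ν U x) x := fun h U hU => by
    obtain ⟨u, hu⟩ := GaussMetric.exists_forall_hasFDerivAt_of_simplyConnected hM
      (hU.U_smooth.differentiableOn (by simp))
      (fun x hx => hU.fderiv_incl_symm hM hg he hx)
    exact ⟨u, hU.isSolution hM hg hA hu, hu⟩
  refine ⟨⟨?_, ?_⟩, ?_, fun u hu => ?_⟩
  · rintro ⟨u, hu⟩
    exact ⟨_, _, hu.isCompatible hM hg he⟩
  · rintro ⟨h, U, hU⟩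
    obtain ⟨u, hu, -⟩ := hcs h U hU
    exact ⟨u, hu⟩
  · intro h U hU
    obtain ⟨u, hu, hu'⟩ := hcs h U hU
    refine ⟨u, hu, hu', fun u' hd => ?_⟩
    have hc : IsPreconnected M := isPreconnected_iff_preconnectedSpace.2 inferInstance
    obtain ⟨c, hc⟩ := hM.exists_is_const_of_fderiv_eq_zero (f := u' - u) hc
      (fun x hx => ((hd x hx).sub (hu' x hx)).differentiableAt.differentiableWithinAt)
      (fun x hx => by rw [((hd x hx).sub (hu' x hx)).fderiv, sub_self]; rfl)
    exact ⟨c, fun x hx => by rw [← hc x hx, Pi.sub_apply]; abel⟩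
  · exact ⟨_, _, hu.isCompatible hM hg he, fun x hx => hu.hasFDerivAt hM hx⟩
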